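/- **Setting.** Let $\mathcal X$ be a measurable space, $k:\mathcal X\times\mathcal X\to\mathbb R$ a symmetric positive (semi)definite kernel with reproducing kernel Hilbert space $\mathcal H_k$, and let the labels be $\mathbb N_m=\{1,\dots,m\}$, with the Kronecker delta kernel $\delta$ and its RKHS $\mathcal H_\delta\cong\mathbb R^m$ (Euclidean inner product). Let $(X_i,Y_i)_{i\ge 1}$ be iid copies of $(X,Y)\in\mathcal X\times\mathbb N_m$, let $p_c(x)=\mathbb P[Y=c\mid X=x]$ be (a fixed regular version of) the class probabilities, and let $$h(x)=\mathbb H[Y\mid X=x]=-\sum_{c=1}^m p_c(x)\log p_c(x).$$ Assume that $x\mapsto k(x,\cdot)\in\mathcal H_k$ is (almost everywhere strongly) measurable with respect to the law of $X$, that $\mathbb E[k(X,X)^2]<\infty$ (for instance $k$ bounded), and that $\mathbb E[g(Y)\mid X=\cdot\,]\in\mathcal H_k$ for every $g\in\mathcal H_\delta$. Put $C_{XX}=\mathbb E[k(X,\cdot)\otimes k(X,\cdot)]:\mathcal H_k\to\mathcal H_k$. For $n\ge1$ and $\lambda>0$ let $K=(k(X_i,X_j))_{i,j\le n}$, $\mathbf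 k(x)=(k(X_i,x))_{i\le n}$, $w(x)=(K+n\lambda I)^{-1}\mathbf k(x)$, and $$\hat\mu_{Y|X=x}=\sum_{i=1}^n w_i(x)\,\delta(Y_i,\cdot)\in\mathcal H_\delta,\qquad \hat p_c(x)=\sum_{i=1}^n \mathbb 1[Y_i=c]\,w_i(x),$$ $$\hat u_x(c)=\begin{cases}-\log\hat p_c(x)&\text{if }\hat p_c(x)>0,\\0&\text{otherwise,}\end{cases}\qquad \hat h_{n,\lambda}(x)=\langle\hat\mu_{Y|X=x},\hat u_x\rangle_{\mathcal H_\delta}.$$ **Theorem (Convergence of the empirical information entropy function).** Let $x\in\mathcal X$ be such that $k(x,\cdot)$ lies in the image of $C_{XX}$ and $p_c(x)>0$ for all $c\in\mathbb N_m$. Then $\hat h_{n,\lambda}(x)$ converges to $h(x)$ at the stochastic rate $O_p\big((n\lambda)^{-1/2}+\lambda^{1/2}\big)$: for every $b>0$ and every $\varepsilon>0$ there is $M>0$ such that, for all $n\ge1$ and all $\lambda>0$ with $n\lambda\ge b$, $$\mathbb P\Big[\big|\hat h_{n,\lambda}(x)-h(x)\big|>M\big((n\lambda)^{-1/2}+\lambda^{1/2}\big)\Big]<\varepsilon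 .$$ In particular, if $\lambda_n>0$, $\lambda_n\to0$ and $n\lambda_n\to\infty$, then $\hat h_{n,\lambda_n}(x)\to h(x)$ in probability. -/

import Mathlib

open MeasureTheory ProbabilityTheory Filter Topology

open scoped Matrix

namespace CondEmbed

section Kernel

variable {𝒳 : Type*} (H : Type*) [NormedAddCommGroup H] [InnerProductSpace ℝ H]
  [CompleteSpace H] [RKHS ℝ H 𝒳 ℝ]

/-- The canonical feature `k(x, ·)` in the reproducing kernel Hilbert space `H` of the kernel. -/
noncomputable def feature (x : 𝒳) : H := RKHS.kerFun H x (1 : ℝ)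

/-- The real-valued reproducing kernel `k(x, x')` of `H`. -/
noncomputable def ker (x x' : 𝒳) : ℝ := RKHS.kernel H x x' (1 : ℝ)

theorem inner_feature_left (x : 𝒳) (f : H) : inner ℝ (feature H x) f = f x := by
  simp [feature]

theorem inner_feature_feature (x x' : 𝒳) :
    inner ℝ (feature H x) (feature H x') = ker H x x' := by
  rw [inner_feature_left, feature, ker, RKHS.kerFun_apply]

/-- The covariance operator `C_XX = E[k(X, ·) ⊗ k(X, ·)] : H → H` for `X` with law `ν`. -/
noncomputable def covXX [MeasurableSpace 𝒳] (ν : Measure 𝒳) : H →L[ℝ] H :=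
  ∫ x, InnerProductSpace.rankOne ℝ (feature H x) (feature H x) ∂ν

end Kernel

section Label

/-- The reproducing kernel Hilbert space of the Kronecker delta on the `m` labels: all functions
on the labels, with the Euclidean inner product. -/
abbrev LabelRKHS (m : ℕ) := EuclideanSpace ℝ (Fin m)

noncomputable instance instRKHSLabel (m : ℕ) : RKHS ℝ (LabelRKHS m) (Fin m) ℝ where
  coeCLM := (EuclideanSpace.equiv (Fin m) ℝ : EuclideanSpace ℝ (Fin m) →L[ℝ] (Fin m → ℝ))
  coeCLM_injective := (EuclideanSpace.equiv (Fin m) ℝ).injective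

theorem feature_label (m : ℕ) (c : Fin m) :
    feature (LabelRKHS m) c = EuclideanSpace.single c (1 : ℝ) := by
  refine ext_inner_right ℝ fun f => ?_
  rw [inner_feature_left, EuclideanSpace.inner_single_left]
  simp only [map_one, one_mul]
  rfl

/-- The reproducing kernel of `LabelRKHS m` is the Kronecker delta. -/
theorem ker_label (m : ℕ) (c c' : Fin m) :
    ker (LabelRKHS m) c c' = if c = c' then 1 else 0 := by
  rw [← inner_feature_feature, feature_label, feature_label, EuclideanSpace.inner_single_left]
  simp

end Label

section Population

variable {𝒳 : Type*} [MeasurableSpace 𝒳] {m : ℕ}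

/-- The decision probability `p_c(x) = P[Y = c | X = x]`, where `κ` is the conditional
distribution of `Y` given `X`. -/
noncomputable def prob (κ : Kernel 𝒳 (Fin m)) (c : Fin m) (x : 𝒳) : ℝ := (κ x).real {c}

/-- The conditional entropy `h(x) = - ∑_c p_c(x) log p_c(x)`, in nats. -/
noncomputable def entropy (κ : Kernel 𝒳 (Fin m)) (x : 𝒳) : ℝ :=
  - ∑ c, prob κ c x * Real.log (prob κ c x)

end Population

section Empirical

variable {𝒳 : Type*} (H : Type*) [NormedAddCommGroup H] [InnerProductSpace ℝ H]
  [CompleteSpace H] [RKHS ℝ H 𝒳 ℝ] {n m : ℕ}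

/-- The Gram matrix `K = (k(x_i, x_j))`. -/
noncomputable def gram (xs : Fin n → 𝒳) : Matrix (Fin n) (Fin n) ℝ :=
  Matrix.of fun i j => ker H (xs i) (xs j)

/-- The weights `(K + n λ I)⁻¹ 𝐤(x)`, where `𝐤(x) = (k(x_i, x))_i`. -/
noncomputable def weights (xs : Fin n → 𝒳) (lam : ℝ) (x : 𝒳) : Fin n → ℝ :=
  (gram H xs + ((n : ℝ) * lam) • (1 : Matrix (Fin n) (Fin n) ℝ))⁻¹ *ᵥ fun i => ker H (xs i) x

/-- The empirical conditional mean embedding `μ̂_{Y|X=x} = Ψ (K + n λ I)⁻¹ 𝐤(x)`, where the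
columns of `Ψ` are the features `δ(y_i, ·)`. -/
noncomputable def embEst (xs : Fin n → 𝒳) (ys : Fin n → Fin m) (lam : ℝ) (x : 𝒳) :
    LabelRKHS m :=
  ∑ i, weights H xs lam x i • feature (LabelRKHS m) (ys i)

/-- The empirical decision probability `p̂_c(x) = 𝟏_cᵀ (K + n λ I)⁻¹ 𝐤(x)`, where
`𝟏_c = (𝟏[y_i = c])_i`. -/
noncomputable def probEst (xs : Fin n → 𝒳) (ys : Fin n → Fin m) (lam : ℝ) (c : Fin m) (x : 𝒳) :
    ℝ :=
  (fun i => if ys i = c then (1 : ℝ) else 0) ⬝ᵥ weights H xs lam x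

/-- The plug-in information `û_x(c)`: `- log p̂_c(x)` if `p̂_c(x) > 0`, and `0` otherwise. -/
noncomputable def infoEst (xs : Fin n → 𝒳) (ys : Fin n → Fin m) (lam : ℝ) (x : 𝒳) (c : Fin m) :
    ℝ :=
  if 0 < probEst H xs ys lam c x then - Real.log (probEst H xs ys lam c x) else 0

/-- The empirical entropy `ĥ(x) = ⟨μ̂_{Y|X=x}, û_x⟩`, with `û_x = ∑_c û_x(c) δ(c, ·)`. -/
noncomputable def entropyEst (xs : Fin n → 𝒳) (ys : Fin n → Fin m) (lam : ℝ) (x : 𝒳) : ℝ :=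
  inner ℝ (embEst H xs ys lam x) (∑ c, infoEst H xs ys lam x c • feature (LabelRKHS m) c)

end Empirical

end CondEmbed

namespace CondEmbed

section SecondMoment

variable {Ω S E : Type*} [MeasurableSpace Ω] [MeasurableSpace S]
  [NormedAddCommGroup E] [InnerProductSpace ℝ E] [CompleteSpace E]
  {P : Measure Ω} {ρ : Measure S} [IsProbabilityMeasure ρ]
  {T : ℕ → Ω → S} {Z : S → E}

theorem integral_norm_sum_sq_of_iIndepFun (hlaw : ∀ i, HasLaw (T i) ρ P) (hindep : iIndepFun T P)
    (hZ : MemLp Z 2 ρ) (hZ0 : ∫ s, Z s ∂ρ = 0) (n : ℕ) :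
    Integrable (fun ω => ‖∑ i : Fin n, Z (T i ω)‖ ^ 2) P ∧
      ∫ ω, ‖∑ i : Fin n, Z (T i ω)‖ ^ 2 ∂P = n * ∫ s, ‖Z s‖ ^ 2 ∂ρ := by
  have hZi : Integrable Z ρ := hZ.integrable (by norm_num)
  have hL : ∀ i, MemLp (fun ω => Z (T i ω)) 2 P := fun i => by
    have h : MemLp Z 2 (P.map (T i)) := by rwa [(hlaw i).map_eq]
    exact h.comp_of_map (hlaw i).aemeasurable
  have hint : ∀ i j, Integrable (fun ω => inner ℝ (Z (T i ω)) (Z (T j ω))) P := fun i j =>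
    memLp_one_iff_integrable.1 ((innerSL ℝ).memLp_of_bilin (r := 1) (hL i) (hL j))
  have hval : ∀ i j, ∫ ω, inner ℝ (Z (T i ω)) (Z (T j ω)) ∂P
      = if i = j then ∫ s, ‖Z s‖ ^ 2 ∂ρ else 0 := fun i j => by
    split_ifs with hij
    · subst hij
      simp only [real_inner_self_eq_norm_sq]
      exact (hlaw i).integral_comp (f := fun s => ‖Z s‖ ^ 2) (hZ.1.norm.pow 2)
    · have h := (hindep.indepFun hij).integral_bilin_comp_comp (f := Z) (g := Z)
        (hlaw i).aemeasurable (hlaw j).aemeasurable (by rwa [(hlaw i).map_eq])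
        (by rwa [(hlaw j).map_eq]) (innerSL ℝ)
      have h0 : ∫ ω, Z (T i ω) ∂P = 0 := ((hlaw i).integral_comp hZ.1).trans hZ0
      rwa [h0, map_zero, zero_apply] at h
  have hexp : ∀ ω, ‖∑ i : Fin n, Z (T i ω)‖ ^ 2
      = ∑ i : Fin n, ∑ j : Fin n, inner ℝ (Z (T i ω)) (Z (T j ω)) := fun ω => by
    rw [← real_inner_self_eq_norm_sq, sum_inner]
    simp_rw [inner_sum]
  simp_rw [hexp]
  refine ⟨integrable_finsetSum _ fun i _ => integrable_finsetSum _ fun j _ => hint _ _, ?_⟩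
  rw [integral_finsetSum _ fun i _ => integrable_finsetSum _ fun j _ => hint _ _]
  simp_rw [integral_finsetSum _ fun j _ => hint _ _, hval, Fin.val_inj]
  simp

theorem measureReal_norm_mean_gt_le [IsProbabilityMeasure P] (hlaw : ∀ i, HasLaw (T i) ρ P)
    (hindep : iIndepFun T P) (hZ : MemLp Z 2 ρ) (hZ0 : ∫ s, Z s ∂ρ = 0) {n : ℕ} (hn : 1 ≤ n)
    {A : ℝ} (hA : 0 < A) :
    P.real {ω | A / √n < ‖(n : ℝ)⁻¹ • ∑ i : Fin n, Z (T i ω)‖}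
      ≤ (∫ s, ‖Z s‖ ^ 2 ∂ρ) / A ^ 2 := by
  obtain ⟨hi, hv⟩ := integral_norm_sum_sq_of_iIndepFun hlaw hindep hZ hZ0 n
  have hn0 : (0 : ℝ) < n := by exact_mod_cast hn
  have hs : 0 < √(n : ℝ) := Real.sqrt_pos.2 hn0
  have hsub : {ω | A / √n < ‖(n : ℝ)⁻¹ • ∑ i : Fin n, Z (T i ω)‖}
      ⊆ {ω | A ^ 2 * n ≤ ‖∑ i : Fin n, Z (T i ω)‖ ^ 2} := by
    intro ω hω
    simp only [Set.mem_ofPred_eq, norm_smul, norm_inv, Real.norm_natCast] at hω ⊢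
    have h1 : A * √n < ‖∑ i : Fin n, Z (T i ω)‖ := by
      rw [div_lt_iff₀ hs, inv_mul_eq_div, div_mul_eq_mul_div, lt_div_iff₀ hn0] at hω
      have : A * √n * √n < ‖∑ i : Fin n, Z (T i ω)‖ * √n := by
        rwa [mul_assoc, Real.mul_self_sqrt hn0.le]
      exact lt_of_mul_lt_mul_right this hs.le
    calc A ^ 2 * n = (A * √n) ^ 2 := by rw [mul_pow, Real.sq_sqrt hn0.le]
      _ ≤ _ := by gcongr
  have hmk := mul_meas_ge_le_integral_of_nonneg (μ := P)
    (Eventually.of_forall fun ω => sq_nonneg ‖∑ i : Fin n, Z (T i ω)‖) hi (A ^ 2 * n)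
  rw [hv] at hmk
  refine (measureReal_mono hsub).trans ?_
  rw [le_div_iff₀ (by positivity)]
  refine le_of_mul_le_mul_right ?_ hn0
  linarith

end SecondMoment

section Entropy

/-- `t ↦ - t log t` for positive `t`, extended by zero, is Lipschitz at `p > 0` relative to every
bounded neighbourhood. -/
theorem exists_abs_negMulLog_max_sub_le {p : ℝ} (hp : 0 < p) (A : ℝ) :
    ∃ L : ℝ, 0 < L ∧ ∀ t : ℝ, |t - p| ≤ A →
      |Real.negMulLog (max t 0) - Real.negMulLog p| ≤ L * |t - p| := by
  set φ : ℝ → ℝ := fun t => Real.negMulLog (max t 0) with hφ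
  have hc : Continuous φ := Real.continuous_negMulLog.comp (continuous_id.max continuous_const)
  have hd : DifferentiableAt ℝ φ p := by
    refine (Real.differentiableAt_negMulLog hp.ne').congr_of_eventuallyEq ?_
    filter_upwards [lt_mem_nhds hp] with t ht
    simp [hφ, max_eq_left ht.le]
  have hds : ContinuousOn (dslope φ p) Set.univ :=
    (continuousOn_dslope univ_mem).2 ⟨hc.continuousOn, hd⟩
  obtain ⟨L, hL⟩ := (isCompact_Icc (a := p - A) (b := p + A)).exists_bound_of_continuousOn
    (hds.mono (Set.subset_univ _))
  refine ⟨max L 1, by positivity, fun t ht => ?_⟩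
  have hmem : t ∈ Set.Icc (p - A) (p + A) := by
    rw [abs_le] at ht
    constructor <;> linarith
  have heq := sub_smul_dslope φ p t
  have hφp : φ p = Real.negMulLog p := by simp [hφ, max_eq_left hp.le]
  rw [hφp] at heq
  change |φ t - _| ≤ _
  rw [← heq, smul_eq_mul, abs_mul, mul_comm]
  gcongr
  exact (hL t hmem).trans (le_max_left _ _)

variable {𝒳 : Type*} (H : Type*) [NormedAddCommGroup H] [InnerProductSpace ℝ H]
  [CompleteSpace H] [RKHS ℝ H 𝒳 ℝ] {n m : ℕ}

theorem embEst_apply (xs : Fin n → 𝒳) (ys : Fin n → Fin m) (lam : ℝ) (x : 𝒳) (c : Fin m) :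
    embEst H xs ys lam x c = probEst H xs ys lam c x := by
  simp [embEst, probEst, feature_label, dotProduct, Pi.single_apply, eq_comm]

theorem entropyEst_eq_sum (xs : Fin n → 𝒳) (ys : Fin n → Fin m) (lam : ℝ) (x : 𝒳) :
    entropyEst H xs ys lam x = ∑ c, Real.negMulLog (max (probEst H xs ys lam c x) 0) := by
  rw [entropyEst, inner_sum]
  refine Finset.sum_congr rfl fun c _ => ?_
  rw [inner_smul_right, feature_label, EuclideanSpace.inner_single_right, embEst_apply, infoEst]
  split_ifs with h
  · simp [Real.negMulLog, max_eq_left h.le]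
    ring
  · simp [max_eq_right (not_lt.1 h)]

theorem entropy_eq_sum [MeasurableSpace 𝒳] (κ : Kernel 𝒳 (Fin m)) (x : 𝒳) :
    entropy κ x = ∑ c, Real.negMulLog (prob κ c x) := by
  simp [entropy, Real.negMulLog]

end Entropy

section Resolvent

variable {𝒳 : Type*} (H : Type*) [NormedAddCommGroup H] [InnerProductSpace ℝ H]
  [CompleteSpace H] [RKHS ℝ H 𝒳 ℝ] {n m : ℕ}

theorem posDef_gram_add (xs : Fin n → 𝒳) {a : ℝ} (ha : 0 < a) :
    (gram H xs + a • (1 : Matrix (Fin n) (Fin n) ℝ)).PosDef := by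
  have h1 : (gram H xs).PosSemidef := by
    have : gram H xs = Matrix.gram ℝ fun i => feature H (xs i) := by
      ext i j
      simp [gram, Matrix.gram, inner_feature_feature]
    rw [this]
    exact Matrix.posSemidef_gram _ _
  exact Matrix.PosDef.posSemidef_add h1 (Matrix.PosDef.one.smul ha)

/-- `(Ĉ + λ)⁻¹ k(x, ·)`, where `Ĉ` is the empirical covariance operator. -/
noncomputable def resolvent (xs : Fin n → 𝒳) (lam : ℝ) (x : 𝒳) : H :=
  lam⁻¹ • (feature H x - ∑ i, weights H xs lam x i • feature H (xs i))

variable {H}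

theorem resolvent_apply (hn : 1 ≤ n) {lam : ℝ} (hlam : 0 < lam) (xs : Fin n → 𝒳) (x : 𝒳)
    (i : Fin n) :
    inner ℝ (feature H (xs i)) (resolvent H xs lam x) = n * weights H xs lam x i := by
  have hn0 : (0 : ℝ) < n := by exact_mod_cast hn
  have hdet := (posDef_gram_add H xs (mul_pos hn0 hlam)).isUnit
  have h : (gram H xs + ((n : ℝ) * lam) • (1 : Matrix (Fin n) (Fin n) ℝ)) *ᵥ weights H xs lam x
      = fun i => ker H (xs i) x := by
    rw [weights, Matrix.mulVec_mulVec, Matrix.mul_nonsing_inv _ ((Matrix.isUnit_iff_isUnit_det _).1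
      hdet), Matrix.one_mulVec]
  have hi := congrFun h i
  rw [Matrix.add_mulVec, Matrix.smul_mulVec, Matrix.one_mulVec, Pi.add_apply, Pi.smul_apply,
    smul_eq_mul] at hi
  rw [resolvent, inner_smul_right, inner_sub_right, inner_feature_feature, inner_sum]
  simp_rw [inner_smul_right, inner_feature_feature]
  rw [← hi]
  have : (gram H xs *ᵥ weights H xs lam x) i
      = ∑ j, weights H xs lam x j * ker H (xs i) (xs j) := by
    simp [gram, Matrix.mulVec, dotProduct, mul_comm]
  rw [this]
  field_simp
  ring

/-- The empirical covariance operator. -/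
noncomputable def empCov (xs : Fin n → 𝒳) (v : H) : H :=
  (n : ℝ)⁻¹ • ∑ i, inner ℝ (feature H (xs i)) v • feature H (xs i)

theorem empCov_sub (xs : Fin n → 𝒳) (u v : H) :
    empCov xs (u - v) = empCov xs u - empCov xs v := by
  simp [empCov, inner_sub_right, sub_smul, smul_sub]

theorem inner_empCov_self_nonneg (xs : Fin n → 𝒳) (v : H) : 0 ≤ inner ℝ v (empCov xs v) := by
  rw [empCov, inner_smul_right, inner_sum]
  refine mul_nonneg (by positivity) (Finset.sum_nonneg fun i _ => ?_)
  rw [inner_smul_right, real_inner_comm v]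
  exact mul_self_nonneg _

theorem empCov_resolvent_add (hn : 1 ≤ n) {lam : ℝ} (hlam : 0 < lam) (xs : Fin n → 𝒳) (x : 𝒳) :
    empCov xs (resolvent H xs lam x) + lam • resolvent H xs lam x = feature H x := by
  have hn0 : (n : ℝ) ≠ 0 := by positivity
  rw [empCov]
  simp_rw [resolvent_apply hn hlam, mul_smul, ← Finset.smul_sum]
  rw [inv_smul_smul₀ hn0, resolvent, smul_inv_smul₀ hlam.ne']
  abel

theorem mul_norm_le_norm_empCov_add {lam : ℝ} (xs : Fin n → 𝒳) (d : H) :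
    lam * ‖d‖ ≤ ‖empCov xs d + lam • d‖ := by
  rcases (norm_nonneg d).eq_or_lt with h | h
  · rw [← h]
    simp
  · refine le_of_mul_le_mul_left ?_ h
    calc ‖d‖ * (lam * ‖d‖) = inner ℝ d (lam • d) := by
          rw [inner_smul_right, real_inner_self_eq_norm_sq]
          ring
      _ ≤ inner ℝ d (empCov xs d + lam • d) := by
          rw [inner_add_right]
          linarith [inner_empCov_self_nonneg xs d]
      _ ≤ _ := real_inner_le_norm _ _

theorem mul_norm_resolvent_le (hn : 1 ≤ n) {lam : ℝ} (hlam : 0 < lam) (xs : Fin n → 𝒳) (x : 𝒳) :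
    lam * ‖resolvent H xs lam x‖ ≤ ‖feature H x‖ := by
  rw [← empCov_resolvent_add hn hlam xs x]
  exact mul_norm_le_norm_empCov_add xs _

theorem mul_norm_resolvent_le_of_source (hn : 1 ≤ n) {lam : ℝ} (hlam : 0 < lam) (xs : Fin n → 𝒳)
    (x : 𝒳) (v : H) :
    lam * ‖resolvent H xs lam x‖ ≤ 2 * lam * ‖v‖ + ‖empCov xs v - feature H x‖ := by
  set u := resolvent H xs lam x with hu
  have h1 := mul_norm_le_norm_empCov_add (lam := lam) xs (u - v)
  have h2 : empCov xs (u - v) + lam • (u - v) = -(empCov xs v - feature H x) - lam • v := by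
    rw [← empCov_resolvent_add hn hlam xs x, empCov_sub, smul_sub]
    abel
  have h3 : ‖-(empCov xs v - feature H x) - lam • v‖ ≤ ‖empCov xs v - feature H x‖ + lam * ‖v‖ := by
    refine (norm_sub_le _ _).trans_eq ?_
    rw [norm_neg, norm_smul, Real.norm_of_nonneg hlam.le]
  have h4 : ‖u‖ ≤ ‖u - v‖ + ‖v‖ := by simpa using norm_add_le (u - v) v
  rw [h2] at h1
  nlinarith

theorem probEst_sub_eq (hn : 1 ≤ n) {lam : ℝ} (hlam : 0 < lam) (xs : Fin n → 𝒳)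
    (ys : Fin n → Fin m) (x : 𝒳) (c : Fin m) (f : H) :
    probEst H xs ys lam c x - f x
      = inner ℝ ((n : ℝ)⁻¹ • ∑ i, ((if ys i = c then (1 : ℝ) else 0) - f (xs i)) • feature H (xs i))
          (resolvent H xs lam x) - lam * inner ℝ f (resolvent H xs lam x) := by
  have hn0 : (n : ℝ) ≠ 0 := by positivity
  have hfx : f x = ∑ i, f (xs i) * weights H xs lam x i
      + lam * inner ℝ f (resolvent H xs lam x) := by
    rw [← inner_feature_left, ← empCov_resolvent_add hn hlam xs x, inner_add_left,
      real_inner_smul_left, real_inner_comm f, empCov]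
    simp_rw [resolvent_apply hn hlam, mul_smul, ← Finset.smul_sum]
    rw [inv_smul_smul₀ hn0, real_inner_comm f, inner_sum]
    simp_rw [inner_smul_right, real_inner_comm _ f, inner_feature_left, mul_comm]
  rw [hfx, real_inner_smul_left, sum_inner]
  simp_rw [real_inner_smul_left, resolvent_apply hn hlam]
  rw [Finset.mul_sum]
  have : ∀ i, (n : ℝ)⁻¹ * (((if ys i = c then (1 : ℝ) else 0) - f (xs i))
      * (n * weights H xs lam x i)) = (if ys i = c then (1 : ℝ) else 0) * weights H xs lam x i
        - f (xs i) * weights H xs lam x i := fun i => by field_simp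
  simp_rw [this, Finset.sum_sub_distrib, probEst, dotProduct]
  ring

end Resolvent

section Moments

variable {𝒳 H : Type*} [NormedAddCommGroup H] [InnerProductSpace ℝ H]
  [CompleteSpace H] [RKHS ℝ H 𝒳 ℝ]

theorem norm_feature_sq (z : 𝒳) : ‖feature H z‖ ^ 2 = ker H z z := by
  rw [← inner_feature_feature, real_inner_self_eq_norm_sq]

variable [MeasurableSpace 𝒳] {m : ℕ} {ν : Measure 𝒳}

theorem memLp_ker_diag (hmeas : AEStronglyMeasurable (fun z => feature H z) ν)
    (hmom : Integrable (fun z => ker H z z ^ 2) ν) : MemLp (fun z => ker H z z) 2 ν := by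
  have h : AEStronglyMeasurable (fun z => ker H z z) ν := by
    simp_rw [← norm_feature_sq]
    exact hmeas.norm.pow 2
  rw [memLp_two_iff_integrable_sq_norm h]
  simpa using hmom

theorem memLp_feature [IsProbabilityMeasure ν]
    (hmeas : AEStronglyMeasurable (fun z => feature H z) ν)
    (hmom : Integrable (fun z => ker H z z ^ 2) ν) : MemLp (fun z => feature H z) 2 ν := by
  rw [memLp_two_iff_integrable_sq_norm hmeas]
  simp_rw [norm_feature_sq]
  exact (memLp_ker_diag hmeas hmom).integrable (by norm_num)

theorem memLp_inner_smul_feature [IsProbabilityMeasure ν]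
    (hmeas : AEStronglyMeasurable (fun z => feature H z) ν)
    (hmom : Integrable (fun z => ker H z z ^ 2) ν) (v : H) :
    MemLp (fun z => inner ℝ (feature H z) v • feature H z) 2 ν := by
  refine (memLp_ker_diag hmeas hmom).of_le_mul (c := ‖v‖)
    ((hmeas.inner aestronglyMeasurable_const).smul hmeas) (Eventually.of_forall fun z => ?_)
  rw [norm_smul, ← norm_feature_sq, Real.norm_of_nonneg (sq_nonneg ‖feature H z‖)]
  calc _ ≤ (‖feature H z‖ * ‖v‖) * ‖feature H z‖ := by
        gcongr
        exact norm_inner_le_norm _ _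
    _ = _ := by ring

theorem covXX_apply [IsProbabilityMeasure ν]
    (hmeas : AEStronglyMeasurable (fun z => feature H z) ν)
    (hmom : Integrable (fun z => ker H z z ^ 2) ν) (v : H) :
    covXX H ν v = ∫ z, inner ℝ (feature H z) v • feature H z ∂ν := by
  have hi : Integrable (fun z => InnerProductSpace.rankOne ℝ (feature H z) (feature H z)) ν := by
    refine ((memLp_ker_diag hmeas hmom).integrable (by norm_num)).mono' ?_
      (Eventually.of_forall fun z => ?_)
    · have hc : Continuous fun h : H => InnerProductSpace.rankOne ℝ h h :=
        (InnerProductSpace.rankOne ℝ (E := H) (F := H)).continuous₂.comp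
          (continuous_id.prodMk continuous_id)
      exact hc.comp_aestronglyMeasurable hmeas
    · rw [InnerProductSpace.norm_rankOne, ← norm_feature_sq, sq]
  rw [covXX, ContinuousLinearMap.integral_apply hi]
  simp only [InnerProductSpace.rankOne_apply]

theorem prob_mem_Icc (κ : Kernel 𝒳 (Fin m)) [IsMarkovKernel κ] (c : Fin m) (z : 𝒳) :
    prob κ c z ∈ Set.Icc (0 : ℝ) 1 :=
  ⟨measureReal_nonneg, measureReal_le_one⟩

theorem integral_indicator_eq_prob (κ : Kernel 𝒳 (Fin m)) (c : Fin m) (z : 𝒳) :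
    ∫ y, (if y = c then (1 : ℝ) else 0) ∂(κ z) = prob κ c z := by
  have h := integral_indicator_one (μ := κ z) (MeasurableSet.singleton c)
  rw [prob, ← h]
  refine integral_congr_ae (Eventually.of_forall fun y => ?_)
  simp [Set.indicator_apply]

theorem aestronglyMeasurable_comp_fst_compProd [IsProbabilityMeasure ν] {E : Type*}
    [TopologicalSpace E] {f : 𝒳 → E} (hf : AEStronglyMeasurable f ν) (κ : Kernel 𝒳 (Fin m)) [IsMarkovKernel κ] :
    AEStronglyMeasurable (fun s : 𝒳 × Fin m => f s.1) (ν ⊗ₘ κ) := by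
  have h : AEStronglyMeasurable f ((ν ⊗ₘ κ).map Prod.fst) := by
    change AEStronglyMeasurable f (Measure.fst (ν ⊗ₘ κ))
    rwa [Measure.fst_compProd]
  exact h.comp_measurable measurable_fst

theorem memLp_noise [IsProbabilityMeasure ν]
    (hmeas : AEStronglyMeasurable (fun z => feature H z) ν)
    (hmom : Integrable (fun z => ker H z z ^ 2) ν) (κ : Kernel 𝒳 (Fin m)) [IsMarkovKernel κ]
    (c : Fin m) {f : H} (hf : ∀ z : 𝒳, f z = prob κ c z) :
    MemLp (fun s : 𝒳 × Fin m => ((if s.2 = c then (1 : ℝ) else 0) - f s.1) • feature H s.1) 2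
      (ν ⊗ₘ κ) := by
  have hφ : MemLp (fun s : 𝒳 × Fin m => feature H s.1) 2 (ν ⊗ₘ κ) := by
    have h : MemLp (fun z => feature H z) 2 ((ν ⊗ₘ κ).map Prod.fst) := by
      change MemLp (fun z => feature H z) 2 (Measure.fst (ν ⊗ₘ κ))
      rw [Measure.fst_compProd]
      exact memLp_feature hmeas hmom
    exact h.comp_of_map measurable_fst.aemeasurable
  have hfm : AEStronglyMeasurable (fun z => f z) ν := by
    simp_rw [← inner_feature_left]
    exact hmeas.inner aestronglyMeasurable_const
  have hind : Measurable fun s : 𝒳 × Fin m => if s.2 = c then (1 : ℝ) else 0 :=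
    (measurable_of_finite fun y : Fin m => if y = c then (1 : ℝ) else 0).comp measurable_snd
  refine hφ.of_le ((hind.aestronglyMeasurable.sub
    (aestronglyMeasurable_comp_fst_compProd hfm κ)).smul hφ.1) (Eventually.of_forall fun s => ?_)
  rw [norm_smul]
  refine mul_le_of_le_one_left (norm_nonneg _) ?_
  obtain ⟨h0, h1⟩ := prob_mem_Icc κ c s.1
  rw [hf, Real.norm_eq_abs, abs_le]
  split_ifs <;> constructor <;> linarith

theorem integral_noise [IsProbabilityMeasure ν]
    (hmeas : AEStronglyMeasurable (fun z => feature H z) ν)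
    (hmom : Integrable (fun z => ker H z z ^ 2) ν) (κ : Kernel 𝒳 (Fin m)) [IsMarkovKernel κ]
    (c : Fin m) {f : H} (hf : ∀ z : 𝒳, f z = prob κ c z) :
    ∫ s : 𝒳 × Fin m, ((if s.2 = c then (1 : ℝ) else 0) - f s.1) • feature H s.1 ∂(ν ⊗ₘ κ) = 0 := by
  rw [Measure.integral_compProd ((memLp_noise hmeas hmom κ c hf).integrable (by norm_num))]
  refine integral_eq_zero_of_ae (Eventually.of_forall fun z => ?_)
  change ∫ y, ((if y = c then (1 : ℝ) else 0) - f z) • feature H z ∂(κ z) = 0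
  rw [integral_smul_const, integral_sub Integrable.of_finite Integrable.of_finite,
    integral_indicator_eq_prob, hf]
  simp

end Moments

section Rates

theorem rate_bounds {A b V F f lam D G U Δ : ℝ} (hA : 0 < A) (hb : 0 < b) (hV : 0 ≤ V)
    (hF : 0 ≤ F) (hf : 0 ≤ f) {n : ℕ} (hn : 1 ≤ n) (hlam : 0 < lam) (hbn : b ≤ n * lam)
    (hU : 0 ≤ U) (hD : D ≤ A / √n) (hG : G ≤ A / √n) (hUF : lam * U ≤ F)
    (hUV : lam * U ≤ 2 * lam * V + D) (hΔ : Δ ≤ G * U + lam * (f * U)) :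
    Δ ≤ A * (2 * V + A / b) + f * F ∧
      Δ ≤ (A * (2 * V + A / √b) + f * (2 * V + A + F))
        * (((n : ℝ) * lam) ^ (-(1 / 2) : ℝ) + lam ^ (1 / 2 : ℝ)) := by
  have hn1 : (1 : ℝ) ≤ n := by exact_mod_cast hn
  have hn0 : (0 : ℝ) < n := by linarith
  rw [Real.rpow_neg (by positivity), ← Real.sqrt_eq_rpow, ← Real.sqrt_eq_rpow,
    Real.sqrt_mul hn0.le]
  have hbs : √b ≤ √n * √lam := by
    rw [← Real.sqrt_mul hn0.le]
    exact Real.sqrt_le_sqrt hbn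
  have hs1 : 1 ≤ √(n : ℝ) := Real.one_le_sqrt.2 hn1
  have hb' : √b * √b = b := Real.mul_self_sqrt hb.le
  have hq' : √lam * √lam = lam := Real.mul_self_sqrt hlam.le
  have hβ : 0 < √b := Real.sqrt_pos.2 hb
  have hq : 0 < √lam := Real.sqrt_pos.2 hlam
  generalize √(n : ℝ) = s at *
  generalize √lam = q at *
  generalize √b = β at *
  subst hb' hq'
  have hs : 0 < s := by linarith
  set t := (s * q)⁻¹ with ht
  have ht0 : 0 < t := by positivity
  have htβ : t ≤ 1 / β := by
    rw [ht, inv_eq_one_div]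
    exact one_div_le_one_div_of_le hβ hbs
  have hsi : A / s = A * (t * q) := by
    rw [ht]
    field_simp
  rw [hsi] at hD hG
  have htq1 : t * q ≤ 1 := by
    have : t * q = s⁻¹ := by
      rw [ht]
      field_simp
    rw [this]
    exact inv_le_one_of_one_le₀ hs1
  have htqr : t * q ≤ t + q := by
    rcases le_total q 1 with h | h
    · nlinarith
    · nlinarith
  have hU2 : q * U ≤ 2 * q * V + A * t := by
    refine le_of_mul_le_mul_left ?_ hq
    nlinarith
  have hGU : G * U ≤ A * (2 * V * (t * q) + A * (t * t)) := by
    calc G * U ≤ A * (t * q) * U := by gcongr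
      _ = A * t * (q * U) := by ring
      _ ≤ A * t * (2 * q * V + A * t) := by gcongr
      _ = _ := by ring
  have hfU1 : q * q * (f * U) ≤ f * F := by nlinarith
  have hfU2 : q * q * (f * U) ≤ f * ((2 * V + A + F) * (t + q)) := by
    have : q * q * U ≤ (2 * V + A + F) * (t + q) := by
      rcases le_total q 1 with h | h
      · have h1 : q * q * V ≤ q * V := by nlinarith [mul_nonneg hq.le hV]
        have h2 : A * (t * q) ≤ A * (t + q) := by gcongr
        nlinarith [mul_nonneg hV ht0.le, mul_nonneg hF ht0.le, mul_nonneg hF hq.le]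
      · have h1 : F ≤ F * q := by nlinarith
        nlinarith [mul_nonneg hV ht0.le, mul_nonneg hV hq.le, mul_nonneg hF ht0.le,
          mul_pos hA ht0, mul_pos hA hq]
    calc q * q * (f * U) = f * (q * q * U) := by ring
      _ ≤ _ := by gcongr
  have htt : t * t ≤ 1 / (β * β) := by
    calc t * t ≤ (1 / β) * (1 / β) := by gcongr
      _ = _ := by ring
  have htt2 : t * t ≤ 1 / β * (t + q) := by
    calc t * t ≤ 1 / β * t := by gcongr
      _ ≤ _ := by
        gcongr
        linarith
  constructor
  · calc Δ ≤ A * (2 * V * (t * q) + A * (t * t)) + f * F := by linarith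
      _ ≤ A * (2 * V * 1 + A * (1 / (β * β))) + f * F := by gcongr
      _ = _ := by ring
  · calc Δ ≤ A * (2 * V * (t * q) + A * (t * t)) + f * ((2 * V + A + F) * (t + q)) := by linarith
      _ ≤ A * (2 * V * (t + q) + A * (1 / β * (t + q))) + f * ((2 * V + A + F) * (t + q)) := by
        gcongr
      _ = _ := by ring

end Rates

section Convergence

variable {Ω 𝒳 H : Type*} [MeasurableSpace 𝒳] [NormedAddCommGroup H] [InnerProductSpace ℝ H]
  [CompleteSpace H] [RKHS ℝ H 𝒳 ℝ] {m : ℕ} {ν : Measure 𝒳} {κ : Kernel 𝒳 (Fin m)}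
  {X : ℕ → Ω → 𝒳} {Y : ℕ → Ω → Fin m}

/-- The event that the empirical covariance operator at `v`, or one of the empirical means of the
label noise `(𝟏[Y = c] - f_c(X)) k(X, ·)`, deviates from its expectation by more than `r`. -/
def deviationEvent (X : ℕ → Ω → 𝒳) (Y : ℕ → Ω → Fin m) (n : ℕ) (v h : H) (f : Fin m → H)
    (r : ℝ) : Set Ω :=
  {ω | r < ‖empCov (fun i : Fin n => X i ω) v - h‖} ∪
    ⋃ c, {ω | r < ‖(n : ℝ)⁻¹ • ∑ i : Fin n,
      ((if Y i ω = c then (1 : ℝ) else 0) - f c (X i ω)) • feature H (X i ω)‖}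

theorem exists_abs_entropyEst_sub_le {x : 𝒳} {v : H} (hpos : ∀ c, 0 < prob κ c x) {f : Fin m → H}
    (hf : ∀ c, ∀ z : 𝒳, f c z = prob κ c z) {A b : ℝ} (hA : 0 < A) (hb : 0 < b) :
    ∃ M : ℝ, 0 < M ∧ ∀ n : ℕ, 1 ≤ n → ∀ lam : ℝ, 0 < lam → b ≤ n * lam →
      ∀ ω ∉ deviationEvent X Y n v (feature H x) f (A / √n),
        |entropyEst H (fun i : Fin n => X i ω) (fun i : Fin n => Y i ω) lam x - entropy κ x|
          ≤ M * (((n : ℝ) * lam) ^ (-(1 / 2) : ℝ) + lam ^ (1 / 2 : ℝ)) := by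
  choose L hL0 hL using fun c => exists_abs_negMulLog_max_sub_le (hpos c)
    (A * (2 * ‖v‖ + A / b) + ‖f c‖ * ‖feature H x‖)
  set B : Fin m → ℝ := fun c =>
    A * (2 * ‖v‖ + A / √b) + ‖f c‖ * (2 * ‖v‖ + A + ‖feature H x‖) with hB
  have hB0 : ∀ c, 0 ≤ L c * B c := fun c => mul_nonneg (hL0 c).le (by positivity)
  have hM0 : 0 ≤ ∑ c, L c * B c := Finset.sum_nonneg fun c _ => hB0 c
  refine ⟨∑ c, L c * B c + 1, by positivity, fun n hn lam hlam hbn ω hω => ?_⟩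
  set xs : Fin n → 𝒳 := fun i => X i ω
  set ys : Fin n → Fin m := fun i => Y i ω
  set r := ((n : ℝ) * lam) ^ (-(1 / 2) : ℝ) + lam ^ (1 / 2 : ℝ)
  have hr : 0 ≤ r := by positivity
  simp only [deviationEvent, Set.mem_union, Set.mem_iUnion, Set.mem_ofPred_eq, not_or, not_exists,
    not_lt] at hω
  have hΔ : ∀ c, |probEst H xs ys lam c x - prob κ c x|
      ≤ ‖(n : ℝ)⁻¹ • ∑ i, ((if ys i = c then (1 : ℝ) else 0) - f c (xs i)) • feature H (xs i)‖
        * ‖resolvent H xs lam x‖ + lam * (‖f c‖ * ‖resolvent H xs lam x‖) := fun c => by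
    rw [← hf c x, probEst_sub_eq hn hlam]
    refine (abs_sub _ _).trans (add_le_add (abs_real_inner_le_norm _ _) ?_)
    rw [abs_mul, abs_of_pos hlam]
    gcongr
    exact abs_real_inner_le_norm _ _
  have hrate := fun c => rate_bounds hA hb (norm_nonneg v) (norm_nonneg (feature H x))
    (norm_nonneg (f c)) hn hlam hbn (norm_nonneg _) hω.1 (hω.2 c)
    (mul_norm_resolvent_le hn hlam xs x) (mul_norm_resolvent_le_of_source hn hlam xs x v) (hΔ c)
  rw [entropyEst_eq_sum, entropy_eq_sum, ← Finset.sum_sub_distrib]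
  calc _ ≤ ∑ c, |Real.negMulLog (max (probEst H xs ys lam c x) 0) - Real.negMulLog (prob κ c x)| :=
        Finset.abs_sum_le_sum_abs _ _
    _ ≤ ∑ c, L c * B c * r := Finset.sum_le_sum fun c _ => by
        refine (hL c _ (hrate c).1).trans ?_
        rw [mul_assoc]
        exact mul_le_mul_of_nonneg_left (hrate c).2 (hL0 c).le
    _ = (∑ c, L c * B c) * r := (Finset.sum_mul _ _ _).symm
    _ ≤ _ := by
        gcongr
        linarith

variable [MeasurableSpace Ω] {P : Measure Ω} [IsProbabilityMeasure P] [IsProbabilityMeasure ν]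
  [IsMarkovKernel κ]

theorem measureReal_empCov_sub_gt_le (hlaw : ∀ i, HasLaw (X i) ν P) (hindep : iIndepFun X P)
    (hmeas : AEStronglyMeasurable (fun z => feature H z) ν)
    (hmom : Integrable (fun z => ker H z z ^ 2) ν) (v : H) :
    ∃ V : ℝ, 0 ≤ V ∧ ∀ n : ℕ, 1 ≤ n → ∀ A : ℝ, 0 < A →
      P.real {ω | A / √n < ‖empCov (fun i : Fin n => X i ω) v - covXX H ν v‖} ≤ V / A ^ 2 := by
  set Z : 𝒳 → H := fun z => inner ℝ (feature H z) v • feature H z - covXX H ν v with hZdef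
  have hφ := memLp_inner_smul_feature hmeas hmom v
  have hZ : MemLp Z 2 ν := hφ.sub (memLp_const _)
  have hZ0 : ∫ z, Z z ∂ν = 0 := by
    rw [hZdef, integral_sub (hφ.integrable (by norm_num)) (integrable_const _),
      ← covXX_apply hmeas hmom]
    simp
  refine ⟨∫ z, ‖Z z‖ ^ 2 ∂ν, integral_nonneg fun z => sq_nonneg _, fun n hn A hA => ?_⟩
  have hn0 : (n : ℝ) ≠ 0 := by positivity
  refine Eq.trans_le ?_ (measureReal_norm_mean_gt_le hlaw hindep hZ hZ0 hn hA)
  congr 1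
  ext ω
  have : empCov (fun i : Fin n => X i ω) v - covXX H ν v
      = (n : ℝ)⁻¹ • ∑ i : Fin n, Z (X i ω) := by
    simp [hZdef, empCov, Finset.sum_sub_distrib, smul_sub, ← Nat.cast_smul_eq_nsmul ℝ,
      inv_smul_smul₀ hn0]
  rw [Set.mem_ofPred_eq, Set.mem_ofPred_eq, this]

theorem exists_measureReal_deviationEvent_lt
    (hlaw : ∀ i, HasLaw (fun ω => (X i ω, Y i ω)) (ν ⊗ₘ κ) P)
    (hindep : iIndepFun (fun i ω => (X i ω, Y i ω)) P)
    (hmeas : AEStronglyMeasurable (fun z => feature H z) ν)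
    (hmom : Integrable (fun z => ker H z z ^ 2) ν) (v : H) {f : Fin m → H}
    (hf : ∀ c, ∀ z : 𝒳, f c z = prob κ c z) {ε : ℝ} (hε : 0 < ε) :
    ∃ A : ℝ, 0 < A ∧ ∀ n : ℕ, 1 ≤ n →
      P.real (deviationEvent X Y n v (covXX H ν v) f (A / √n)) < ε := by
  have hfst : MeasurePreserving Prod.fst (ν ⊗ₘ κ) ν := ⟨measurable_fst, Measure.fst_compProd ν κ⟩
  obtain ⟨V, hV, hcov⟩ := measureReal_empCov_sub_gt_le (X := X)
    (fun i => hfst.fun_comp_hasLaw (hlaw i))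
    (hindep.comp (fun _ => Prod.fst) fun _ => measurable_fst) hmeas hmom v
  set W : Fin m → ℝ := fun c => ∫ s : 𝒳 × Fin m,
    ‖((if s.2 = c then (1 : ℝ) else 0) - f c s.1) • feature H s.1‖ ^ 2 ∂(ν ⊗ₘ κ) with hW
  have hW0 : 0 ≤ ∑ c, W c := Finset.sum_nonneg fun c _ => integral_nonneg fun s => sq_nonneg _
  have hT : 0 < V + ∑ c, W c + 1 := by positivity
  refine ⟨√((V + ∑ c, W c + 1) / ε), by positivity, fun n hn => ?_⟩
  set A := √((V + ∑ c, W c + 1) / ε) with hA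
  have hA0 : 0 < A := by positivity
  have hA2 : A ^ 2 = (V + ∑ c, W c + 1) / ε := Real.sq_sqrt (by positivity)
  have hnoise := fun c => measureReal_norm_mean_gt_le hlaw hindep (memLp_noise hmeas hmom κ c (hf c))
    (integral_noise hmeas hmom κ c (hf c)) hn hA0
  calc P.real (deviationEvent X Y n v (covXX H ν v) f (A / √n))
      ≤ V / A ^ 2 + ∑ c, W c / A ^ 2 := by
        refine (measureReal_union_le _ _).trans (add_le_add (hcov n hn A hA0) ?_)
        exact (measureReal_iUnion_fintype_le _).trans (Finset.sum_le_sum fun c _ => hnoise c)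
    _ = (V + ∑ c, W c) / A ^ 2 := by rw [← Finset.sum_div, ← add_div]
    _ < ε := by
        rw [hA2, div_div_eq_mul_div, div_lt_iff₀ hT, mul_comm]
        exact mul_lt_mul_of_pos_left (by linarith) hε

theorem tendstoInMeasure_of_rate {g : ℕ → ℝ → Ω → ℝ} {h : ℝ}
    (hrate : ∀ ε : ℝ, 0 < ε → ∃ M : ℝ, 0 < M ∧ ∀ n : ℕ, 1 ≤ n → ∀ lam : ℝ, 0 < lam →
      1 ≤ n * lam → P.real {ω | M * (((n : ℝ) * lam) ^ (-(1 / 2) : ℝ) + lam ^ (1 / 2 : ℝ))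
        < |g n lam ω - h|} < ε)
    {lam : ℕ → ℝ} (hlam : ∀ n, 0 < lam n) (hlam0 : Tendsto lam atTop (𝓝 0))
    (hnlam : Tendsto (fun n : ℕ => (n : ℝ) * lam n) atTop atTop) :
    TendstoInMeasure P (fun n ω => g n (lam n) ω) atTop fun _ => h := by
  rw [tendstoInMeasure_iff_measureReal_norm]
  intro δ hδ
  rw [Metric.tendsto_atTop']
  intro ε hε
  obtain ⟨M, hM, hbound⟩ := hrate ε hε
  have h1 : Tendsto (fun n : ℕ => M * (((n : ℝ) * lam n) ^ (-(1 / 2) : ℝ)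
      + lam n ^ (1 / 2 : ℝ))) atTop (𝓝 0) := by
    have ha := (tendsto_rpow_neg_atTop (y := 1 / 2) (by norm_num)).comp hnlam
    have hb := hlam0.rpow_const (p := 1 / 2) (Or.inr (by norm_num))
    rw [Real.zero_rpow (by norm_num)] at hb
    simpa using (ha.add hb).const_mul M
  obtain ⟨N, hN⟩ := eventually_atTop.1 (((h1.eventually_lt_const hδ).and
    (hnlam.eventually_ge_atTop 1)).and (eventually_ge_atTop 1))
  refine ⟨N, fun n hn => ?_⟩
  obtain ⟨⟨hlt, hge⟩, hn1⟩ := hN n (le_of_lt hn)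
  rw [Real.dist_eq, sub_zero, abs_of_nonneg measureReal_nonneg]
  refine (measureReal_mono fun ω hω => ?_).trans_lt (hbound n hn1 (lam n) (hlam n) hge)
  exact hlt.trans_le hω

end Convergence

end CondEmbed

theorem mainTheorem5
    {Ω 𝒳 H : Type*} [MeasurableSpace Ω] [MeasurableSpace 𝒳]
    [NormedAddCommGroup H] [InnerProductSpace ℝ H] [CompleteSpace H] [RKHS ℝ H 𝒳 ℝ]
    {m : ℕ}
    -- the law `ν` of `X`, the conditional distribution `κ` of `Y` given `X`, and an iid sample
    (P : Measure Ω) [IsProbabilityMeasure P]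
    (ν : Measure 𝒳) [IsProbabilityMeasure ν] (κ : Kernel 𝒳 (Fin m)) [IsMarkovKernel κ]
    (X : ℕ → Ω → 𝒳) (Y : ℕ → Ω → Fin m)
    (hlaw : ∀ i, HasLaw (fun ω => (X i ω, Y i ω)) (ν ⊗ₘ κ) P)
    (hindep : iIndepFun (fun i ω => (X i ω, Y i ω)) P)
    -- `E[k(X, X)²] < ∞`
    (hmeas : AEStronglyMeasurable (fun z => CondEmbed.feature H z) ν)
    (hmom : Integrable (fun z => CondEmbed.ker H z z ^ 2) ν)
    -- `E[g(Y) | X = ·]` lies in the RKHS of `k` for every function `g` of the label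
    (hcond : ∀ g : Fin m → ℝ, ∃ f : H, ∀ z : 𝒳, f z = ∫ y, g y ∂(κ z))
    (x : 𝒳)
    (himage : CondEmbed.feature H x ∈ Set.range (CondEmbed.covXX H ν))
    (hpos : ∀ c : Fin m, 0 < CondEmbed.prob κ c x) :
    (∀ b : ℝ, 0 < b → ∀ ε : ℝ, 0 < ε → ∃ M : ℝ, 0 < M ∧
      ∀ n : ℕ, 1 ≤ n → ∀ lam : ℝ, 0 < lam → b ≤ n * lam →
        P.real {ω | M * (((n : ℝ) * lam) ^ (-(1 / 2) : ℝ) + lam ^ (1 / 2 : ℝ)) <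
          |CondEmbed.entropyEst H (fun i : Fin n => X i ω) (fun i : Fin n => Y i ω) lam x
            - CondEmbed.entropy κ x|} < ε) ∧
    (∀ lam : ℕ → ℝ, (∀ n, 0 < lam n) → Tendsto lam atTop (𝓝 0) →
      Tendsto (fun n : ℕ => (n : ℝ) * lam n) atTop atTop →
        TendstoInMeasure P
          (fun (n : ℕ) ω => CondEmbed.entropyEst H (fun i : Fin n => X i ω)
            (fun i : Fin n => Y i ω) (lam n) x)
          atTop (fun _ => CondEmbed.entropy κ x)) := by
  choose f hf using fun c : Fin m => hcond fun y => if y = c then 1 else 0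
  simp_rw [CondEmbed.integral_indicator_eq_prob] at hf
  obtain ⟨v, hv⟩ := himage
  have hrate : ∀ b : ℝ, 0 < b → ∀ ε : ℝ, 0 < ε → ∃ M : ℝ, 0 < M ∧
      ∀ n : ℕ, 1 ≤ n → ∀ lam : ℝ, 0 < lam → b ≤ n * lam →
        P.real {ω | M * (((n : ℝ) * lam) ^ (-(1 / 2) : ℝ) + lam ^ (1 / 2 : ℝ)) <
          |CondEmbed.entropyEst H (fun i : Fin n => X i ω) (fun i : Fin n => Y i ω) lam x
            - CondEmbed.entropy κ x|} < ε := by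
    intro b hb ε hε
    obtain ⟨A, hA, hdev⟩ :=
      CondEmbed.exists_measureReal_deviationEvent_lt hlaw hindep hmeas hmom v hf hε
    rw [hv] at hdev
    obtain ⟨M, hM, hent⟩ := CondEmbed.exists_abs_entropyEst_sub_le (X := X) (Y := Y) (v := v)
      hpos hf hA hb
    refine ⟨M, hM, fun n hn lam hlam hbn => (measureReal_mono fun ω hω => ?_).trans_lt (hdev n hn)⟩
    by_contra hnot
    exact absurd (hent n hn lam hlam hbn ω hnot) (not_le.2 hω)
  exact ⟨hrate, fun lam hlam hlam0 hnlam => CondEmbed.tendstoInMeasure_of_rate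
    (g := fun n lam ω =>
      CondEmbed.entropyEst H (fun i : Fin n => X i ω) (fun i : Fin n => Y i ω) lam x)
    (hrate 1 one_pos) hlam hlam0 hnlam⟩
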